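/- Let $\mathcal{E}$ be an exact category (in the sense of Quillen): an additive category with a class of kernel–cokernel pairs $X\rightarrowtail Y\twoheadrightarrow Z$, called conflations, closed under isomorphism, such that, calling their first maps inflations and their second maps deflations, every map $X\to 0$ is a deflation, deflations are closed under composition, pullbacks along deflations exist and pullbacks of deflations are deflations, and dually for inflations. A morphism is admissible if it is a deflation followed by an inflation. Let $\Upsilon\colon A\mapsto \operatorname{Hom}_{\mathcal{E}}(-,A)$ be the Yoneda embedding into the abelian category $\operatorname{Mod}(\mathcal{E})$ of additive contravariant functors from $\mathcal{E}$ to abelian groups. Let $\operatorname{mod}_{\mathrm{adm}}(\mathcal{E})$ (respectively $\operatorname{eff}(\mathcal{E})$) be the full subcategory of those functors $F$ for which there is an exact sequence $\Upsilon(X)\xrightarrow{\Upsilon(f)}\Upsilon(Y)\to F\to 0$ with $f$ admissible (respectively, $f$ a deflation). The conflations of $\operatorname{mod}_{\mathrm{adm}}(\mathcal{E})$ are the sequences in it that are short exact in $\operatorname{Mod}(\mathcal{E})$. In a category with conflations, an object $P$ is projective if every morphism $P\to Y$ lifts along every deflation $X\twoheadrightarrow Y$; there are enough projectives if every object $A$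 admits a deflation $P\twoheadrightarrow A$ with $P$ projective; $\operatorname{gen}(\mathcal{X})$ is the class of objects $A$ admitting a deflation $X\twoheadrightarrow A$ with $X\in\mathcal{X}$; ${}^{\perp}\mathcal{X}$ is the class of objects $A$ with $\operatorname{Hom}(A,X)=0$ for all $X\in\mathcal{X}$; and a torsion pair is a pair $(\mathcal{T},\mathcal{F})$ of full subcategories closed under isomorphism such that $\operatorname{Hom}(T,F)=0$ for all $T\in\mathcal{T}$, $F\in\mathcal{F}$, and every object $M$ sits in a conflation $T\rightarrowtail M\twoheadrightarrow F$ with $T\in\mathcal{T}$, $F\in\mathcal{F}$. Let $\mathcal{Q}$ be the full subcategory of projective objects of $\operatorname{mod}_{\mathrm{adm}}(\mathcal{E})$, and form $\operatorname{gen}$ and ${}^{\perp}$ inside $\operatorname{mod}_{\mathrm{adm}}(\mathcal{E})$. The following are equivalent: (1) $\mathcal{E}$ has enough projectives; (2) $(\operatorname{gen}(\mathcal{Q}\cap{}^{\perp}\operatorname{eff}(\mathcal{E})),\operatorname{eff}(\mathcal{E}))$ is a torsion pair in $\operatorname{mod}_{\mathrm{adm}}(\mathcal{E})$; (3) for every $P\in\mathcal{Q}$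 there is a conflation $F'\rightarrowtail P\twoheadrightarrow F''$ in $\operatorname{mod}_{\mathrm{adm}}(\mathcal{E})$ with $F'\in\operatorname{gen}(\mathcal{Q}\cap{}^{\perp}\operatorname{eff}(\mathcal{E}))$ and $F''\in\operatorname{eff}(\mathcal{E})$. -/

import Mathlib

open CategoryTheory CategoryTheory.Limits Opposite

universe v u

/-- A conflation structure on a preadditive category `C`: a chosen class of kernel-cokernel pairs
`X ⟶ Y ⟶ Z`, called conflations, closed under isomorphism. -/
structure ConflationStructure (C : Type u) [Category.{v} C] [Preadditive C] where
  /-- The class of conflations. -/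
  IsConflation : ObjectProperty (ShortComplex C)
  closed_iso : IsConflation.IsClosedUnderIsomorphisms
  isKernel : ∀ S : ShortComplex C, IsConflation S →
    Nonempty (IsLimit (KernelFork.ofι S.f S.zero))
  isCokernel : ∀ S : ShortComplex C, IsConflation S →
    Nonempty (IsColimit (CokernelCofork.ofπ S.g S.zero))

namespace ConflationStructure

section Basic

variable {C : Type u} [Category.{v} C] [Preadditive C] (E : ConflationStructure C)

/-- An inflation is the kernel part of a conflation. -/
def IsInflation {X Y : C} (i : X ⟶ Y) : Prop :=
  ∃ (Z : C) (p : Y ⟶ Z) (w : i ≫ p = 0), E.IsConflation (ShortComplex.mk i p w)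

/-- A deflation is the cokernel part of a conflation. -/
def IsDeflation {Y Z : C} (p : Y ⟶ Z) : Prop :=
  ∃ (X : C) (i : X ⟶ Y) (w : i ≫ p = 0), E.IsConflation (ShortComplex.mk i p w)

/-- A morphism is admissible if it is a deflation followed by an inflation. -/
def IsAdmissible {X Y : C} (f : X ⟶ Y) : Prop :=
  ∃ (I : C) (p : X ⟶ I) (i : I ⟶ Y), E.IsDeflation p ∧ E.IsInflation i ∧ p ≫ i = f

/-- The axioms of a (Quillen) exact category for a conflation structure. -/
structure IsExact : Prop where
  /-- Every morphism to a zero object is a deflation. -/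
  deflation_to_zero : ∀ {X Z : C}, IsZero Z → ∀ p : X ⟶ Z, E.IsDeflation p
  /-- Deflations are closed under composition. -/
  deflation_comp : ∀ {X Y Z : C} (p : X ⟶ Y) (q : Y ⟶ Z),
    E.IsDeflation p → E.IsDeflation q → E.IsDeflation (p ≫ q)
  /-- Pullbacks along deflations exist. -/
  hasPullback : ∀ {X Y Z : C} (p : Y ⟶ Z) (f : X ⟶ Z), E.IsDeflation p → HasPullback f p
  /-- Deflations are stable under pullbacks. -/
  deflation_pullback : ∀ {P X Y Z : C} (p' : P ⟶ X) (f' : P ⟶ Y) (f : X ⟶ Z) (p : Y ⟶ Z),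
    IsPullback p' f' f p → E.IsDeflation p → E.IsDeflation p'
  /-- Every morphism from a zero object is an inflation. -/
  inflation_from_zero : ∀ {Z X : C}, IsZero Z → ∀ i : Z ⟶ X, E.IsInflation i
  /-- Inflations are closed under composition. -/
  inflation_comp : ∀ {X Y Z : C} (i : X ⟶ Y) (j : Y ⟶ Z),
    E.IsInflation i → E.IsInflation j → E.IsInflation (i ≫ j)
  /-- Pushouts along inflations exist. -/
  hasPushout : ∀ {X Y Z : C} (i : X ⟶ Y) (f : X ⟶ Z), E.IsInflation i → HasPushout f i
  /-- Inflations are stable under pushouts. -/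
  inflation_pushout : ∀ {P X Y Z : C} (f : X ⟶ Z) (i : X ⟶ Y) (i' : Z ⟶ P) (f' : Y ⟶ P),
    IsPushout f i i' f' → E.IsInflation i → E.IsInflation i'

/-- The projective objects: those `P` such that every morphism `P ⟶ Y` lifts along every
deflation `X ⟶ Y`. -/
def proj : ObjectProperty C := fun P =>
  ∀ ⦃X Y : C⦄ (p : X ⟶ Y), E.IsDeflation p → ∀ f : P ⟶ Y, ∃ g : P ⟶ X, g ≫ p = f

/-- Every object is the target of a deflation from a projective object. -/
def HasEnoughProj : Prop :=
  ∀ A : C, ∃ (P : C) (p : P ⟶ A), E.proj P ∧ E.IsDeflation p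

/-- `gen 𝒳`: the objects `A` admitting an exact sequence `X ⟶ A ⟶ 0`, i.e. a deflation
`X ⟶ A`, with `X` in `𝒳`. -/
def gen (𝒳 : ObjectProperty C) : ObjectProperty C := fun A =>
  ∃ (X : C) (p : X ⟶ A), 𝒳 X ∧ E.IsDeflation p

/-- A torsion pair `(𝒯, ℱ)`. -/
structure IsTorsionPair (𝒯 ℱ : ObjectProperty C) : Prop where
  closed_iso_left : 𝒯.IsClosedUnderIsomorphisms
  closed_iso_right : ℱ.IsClosedUnderIsomorphisms
  hom_eq_zero : ∀ {T F : C}, 𝒯 T → ℱ F → ∀ f : T ⟶ F, f = 0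
  exists_conflation : ∀ M : C, ∃ (T F : C) (i : T ⟶ M) (p : M ⟶ F) (w : i ≫ p = 0),
    𝒯 T ∧ ℱ F ∧ E.IsConflation (ShortComplex.mk i p w)

/-- There is an exact sequence `Υ(X) ⟶ Υ(Y) ⟶ F ⟶ 0` of contravariant functors from `C` to
abelian groups, whose first map is `Υ(f)`, for the Yoneda embedding `Υ`. -/
def Presents {X Y : C} (f : X ⟶ Y) (F : Cᵒᵖ ⥤ AddCommGrpCat.{v}) : Prop :=
  ∃ (π : preadditiveYoneda.obj Y ⟶ F) (w : preadditiveYoneda.map f ≫ π = 0),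
    (ShortComplex.mk (preadditiveYoneda.map f) π w).Exact ∧ Epi π

/-- The functors presented by an admissible morphism. -/
def smodAdm : ObjectProperty (Cᵒᵖ ⥤ AddCommGrpCat.{v}) := fun F =>
  ∃ (X Y : C) (f : X ⟶ Y), E.IsAdmissible f ∧ Presents f F

/-- The effaceable functors: those presented by a deflation. -/
def eff : ObjectProperty (Cᵒᵖ ⥤ AddCommGrpCat.{v}) := fun F =>
  ∃ (X Y : C) (f : X ⟶ Y), E.IsDeflation f ∧ Presents f F

/-- A functor presented by a morphism between representables is additive. -/
lemma Presents.additive {X Y : C} {f : X ⟶ Y} {F : Cᵒᵖ ⥤ AddCommGrpCat.{v}}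
    (h : Presents f F) : F.Additive := by
  obtain ⟨π, -, -, hπ⟩ := h
  refine ⟨fun {A B} a b => ?_⟩
  rw [← cancel_epi (π.app A), ← π.naturality, Functor.map_add, Preadditive.comp_add,
    Preadditive.add_comp, π.naturality, π.naturality]

variable {E} in
/-- In an exact category every effaceable functor is admissibly presented. -/
lemma IsExact.eff_le_smodAdm [HasZeroObject C] (hE : E.IsExact) : E.eff ≤ E.smodAdm := by
  rintro F ⟨X, Y, f, hf, h⟩
  refine ⟨X, Y, f, ⟨Y, f, 𝟙 Y, hf, ?_, Category.comp_id f⟩, h⟩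
  obtain ⟨Z, hZ⟩ := HasZeroObject.zero (C := C)
  obtain ⟨W, i, w, hc⟩ := hE.deflation_to_zero hZ (0 : Y ⟶ Z)
  refine ⟨Z, 0, comp_zero, ?_⟩
  obtain ⟨hk⟩ := E.isKernel _ hc
  have hi : IsIso i := by
    obtain ⟨l, hl⟩ := KernelFork.IsLimit.lift' hk (𝟙 Y) comp_zero
    have hl' : l ≫ i = 𝟙 Y := hl
    refine ⟨l, Fork.IsLimit.hom_ext hk ?_, hl'⟩
    change (i ≫ l) ≫ i = 𝟙 W ≫ i
    rw [Category.assoc, hl', Category.comp_id, Category.id_comp]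
  have := E.closed_iso
  exact E.IsConflation.prop_of_iso
    (ShortComplex.isoMk (S₁ := ShortComplex.mk i 0 w) (S₂ := ShortComplex.mk (𝟙 Y) 0 comp_zero)
      (asIso i) (Iso.refl _) (Iso.refl _) (by simp) (by simp)) hc

end Basic

section SmodAdm

variable {C : Type u} [Category.{v} C] [Preadditive C] (E : ConflationStructure C)

/-- The category of admissibly presented functors, as a full subcategory of the category of
contravariant functors to abelian groups. -/
abbrev SmodAdm := E.smodAdm.FullSubcategory

/-- The conflations of the category of admissibly presented functors: the sequences that are
short exact as sequences of functors. -/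
def smodAdmConflation : ConflationStructure E.SmodAdm where
  IsConflation := fun S => (S.map E.smodAdm.ι).ShortExact
  closed_iso := ⟨fun e h => ShortComplex.shortExact_of_iso (E.smodAdm.ι.mapShortComplex.mapIso e) h⟩
  isKernel := fun S h => ⟨by
    haveI := h.mono_f
    haveI : Mono S.f := E.smodAdm.ι.mono_of_mono_map h.mono_f
    refine KernelFork.IsLimit.ofι' _ _ fun {A} k hk => ?_
    have hk' : E.smodAdm.ι.map k ≫ (S.map E.smodAdm.ι).g = 0 := by
      change E.smodAdm.ι.map k ≫ E.smodAdm.ι.map S.g = 0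
      rw [← Functor.map_comp, hk, Functor.map_zero]
    let l : E.smodAdm.ι.obj A ⟶ E.smodAdm.ι.obj S.X₁ := h.exact.lift _ hk'
    have hl : l ≫ E.smodAdm.ι.map S.f = E.smodAdm.ι.map k := h.exact.lift_f _ hk'
    refine ⟨E.smodAdm.ι.preimage l, E.smodAdm.ι.map_injective ?_⟩
    rw [Functor.map_comp, Functor.map_preimage, hl]⟩
  isCokernel := fun S h => ⟨by
    haveI := h.epi_g
    haveI : Epi S.g := E.smodAdm.ι.epi_of_epi_map h.epi_g
    refine CokernelCofork.IsColimit.ofπ' _ _ fun {A} k hk => ?_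
    have hk' : (S.map E.smodAdm.ι).f ≫ E.smodAdm.ι.map k = 0 := by
      change E.smodAdm.ι.map S.f ≫ E.smodAdm.ι.map k = 0
      rw [← Functor.map_comp, hk, Functor.map_zero]
    let l : E.smodAdm.ι.obj S.X₃ ⟶ E.smodAdm.ι.obj A := h.exact.desc _ hk'
    have hl : E.smodAdm.ι.map S.g ≫ l = E.smodAdm.ι.map k := h.exact.g_desc _ hk'
    refine ⟨E.smodAdm.ι.preimage l, E.smodAdm.ι.map_injective ?_⟩
    rw [Functor.map_comp, Functor.map_preimage, hl]⟩

/-- The effaceable functors as a full subcategory of the admissibly presented ones. -/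
def effAdm : ObjectProperty E.SmodAdm := E.eff.inverseImage E.smodAdm.ι

end SmodAdm

end ConflationStructure

/-!
Write `Υ` for the Yoneda embedding, which takes values in the admissibly presented functors. Two
facts about it drive the proof.

* It makes `C` a reflective subcategory whose objects are projective, the reflection of a functor
  presented by `f` being `Υ(coker f)`. A projective admissibly presented functor is a retract of a
  representable one, so it is representable; and a morphism `m` of `C` has a kernel as soon as
  `Υ(m)` has one.
* Every element of an effaceable functor is killed by pulling it back along a deflation. Hence
  `Hom(Υ(A), F) = 0` for all effaceable `F` if and only if `A` is projective.

If `M` is presented by an admissible `f : X ⟶ Y` and `q : P ⟶ Y` is a deflation from a projective,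
the image of `Υ(P) ⟶ Υ(Y) ⟶ M` is presented by the pullback of `f` along `q`, and its cokernel by
the deflation `(f, q) : X ⊞ P ⟶ Y`. This is the torsion conflation of `M`. Conversely, the torsion
conflation of `Υ(A)` gives a morphism `m : Z ⟶ A` from a projective such that `Υ(m)` is a deflation
onto the torsion part followed by its inclusion. Hence `m` has a kernel, and a deflation onto `A`
that is killed in the torsion-free part factors through `m`, so `m` is a deflation by the obscure
axiom.
-/

namespace ConflationStructure

section Yoneda

variable {C : Type u} [Category.{v} C] [Preadditive C] {F G : Cᵒᵖ ⥤ AddCommGrpCat.{v}}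

instance additive_preadditiveYoneda :
    (preadditiveYoneda : C ⥤ Cᵒᵖ ⥤ AddCommGrpCat.{v}).Additive where
  map_add {X Y f g} := by
    ext V (a : V.unop ⟶ X)
    exact Preadditive.comp_add _ _ _ a f g

/-- The Yoneda lemma for additive functors to abelian groups: evaluation at the identity. -/
def preadditiveYonedaEquiv [F.Additive] {W : C} :
    (preadditiveYoneda.obj W ⟶ F) ≃ F.obj (op W) where
  toFun φ := φ.app (op W) (𝟙 W : W ⟶ W)
  invFun x :=
    { app V := AddCommGrpCat.ofHom <|
        AddMonoidHom.mk' (fun a : V.unop ⟶ W => F.map a.op x) fun a b : V.unop ⟶ W =>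
          congr($(F.map_add (f := a.op) (g := b.op)).hom x)
      naturality V V' g := by
        ext (a : V.unop ⟶ W)
        change F.map (g.unop ≫ a).op x = F.map g (F.map a.op x)
        rw [op_comp, F.map_comp]
        rfl }
  left_inv φ := by
    ext V (a : V.unop ⟶ W)
    have h : φ.app V (a ≫ 𝟙 W) = F.map a.op (φ.app (op W) (𝟙 W : W ⟶ W)) :=
      congr($(φ.naturality a.op).hom (𝟙 W : W ⟶ W))
    rw [Category.comp_id] at h
    exact h.symm
  right_inv x := congr($(F.map_id (op W)).hom x)

lemma epi_iff_forall_exists_comp_eq [F.Additive] [G.Additive] (p : F ⟶ G) :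
    Epi p ↔ ∀ (W : C) (x : preadditiveYoneda.obj W ⟶ G), ∃ y, y ≫ p = x := by
  simp only [NatTrans.epi_iff_epi_app, AddCommGrpCat.epi_iff_surjective]
  refine ⟨fun h W x => ?_, fun h V t => ?_⟩
  · obtain ⟨t, ht⟩ := h (op W) (preadditiveYonedaEquiv x)
    obtain ⟨y, rfl⟩ := preadditiveYonedaEquiv.surjective t
    exact ⟨y, preadditiveYonedaEquiv.injective ht⟩
  · obtain ⟨x, rfl⟩ := (preadditiveYonedaEquiv (W := V.unop)).surjective t
    obtain ⟨y, rfl⟩ := h _ x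
    exact ⟨preadditiveYonedaEquiv y, rfl⟩

lemma additive_of_mono [G.Additive] (i : F ⟶ G) [Mono i] : F.Additive where
  map_add {A B a b} := by
    rw [← cancel_mono (i.app B), i.naturality, Functor.map_add, Preadditive.comp_add,
      Preadditive.add_comp, i.naturality, i.naturality]

lemma exact_iff_forall_exists_comp_eq (S : ShortComplex (Cᵒᵖ ⥤ AddCommGrpCat.{v}))
    [S.X₁.Additive] [S.X₂.Additive] :
    S.Exact ↔ ∀ (W : C) (x : preadditiveYoneda.obj W ⟶ S.X₂), x ≫ S.g = 0 → ∃ y, y ≫ S.f = x := by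
  have := additive_of_mono (kernel.ι S.g)
  rw [S.exact_iff_epi_kernel_lift, epi_iff_forall_exists_comp_eq]
  refine ⟨fun h W x hx => ?_, fun h W x => ?_⟩
  · obtain ⟨y, hy⟩ := h W (kernel.lift S.g x hx)
    exact ⟨y, by simpa using hy =≫ kernel.ι S.g⟩
  · obtain ⟨y, hy⟩ := h W (x ≫ kernel.ι S.g) (by simp)
    exact ⟨y, by simpa [← cancel_mono (kernel.ι S.g)] using hy⟩

/-- The epimorphism `π : Υ(Y) ⟶ F` exhibits `F` as the functor presented by `f : X ⟶ Y`. Exactness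
of `Υ(X) ⟶ Υ(Y) ⟶ F` at `Υ(Y)` is expressed on morphisms of `C`, through the Yoneda lemma. -/
structure IsPresentation {X Y : C} (f : X ⟶ Y) (π : preadditiveYoneda.obj Y ⟶ F) : Prop where
  epi : Epi π
  map_comp_eq_zero_iff : ∀ {W : C} (a : W ⟶ Y),
    preadditiveYoneda.map a ≫ π = 0 ↔ ∃ b : W ⟶ X, b ≫ f = a

namespace IsPresentation

variable {X Y : C} {f : X ⟶ Y} {π : preadditiveYoneda.obj Y ⟶ F}

lemma map_comp (h : IsPresentation f π) : preadditiveYoneda.map f ≫ π = 0 :=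
  (h.map_comp_eq_zero_iff f).2 ⟨𝟙 X, Category.id_comp f⟩

end IsPresentation

lemma isPresentation_iff_exact {X Y : C} {f : X ⟶ Y} {π : preadditiveYoneda.obj Y ⟶ F} :
    IsPresentation f π ↔ Epi π ∧ ∃ w : preadditiveYoneda.map f ≫ π = 0,
      (ShortComplex.mk (preadditiveYoneda.map f) π w).Exact := by
  simp only [exact_iff_forall_exists_comp_eq]
  constructor
  · refine fun h => ⟨h.epi, h.map_comp, fun W x hx => ?_⟩
    obtain ⟨a, rfl⟩ := preadditiveYoneda.map_surjective x
    obtain ⟨b, rfl⟩ := (h.map_comp_eq_zero_iff a).1 hx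
    exact ⟨preadditiveYoneda.map b, (preadditiveYoneda.map_comp b f).symm⟩
  · rintro ⟨hπ, w, h⟩
    refine ⟨hπ, fun a => ⟨fun ha => ?_, ?_⟩⟩
    · obtain ⟨y, hy⟩ := h _ _ ha
      exact ⟨preadditiveYoneda.preimage y, preadditiveYoneda.map_injective (by simpa using hy)⟩
    · rintro ⟨b, rfl⟩
      rw [Functor.map_comp_assoc, w, comp_zero]

lemma presents_iff_exists_isPresentation {X Y : C} {f : X ⟶ Y} :
    Presents f F ↔ ∃ π : preadditiveYoneda.obj Y ⟶ F, IsPresentation f π := by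
  simp only [Presents, isPresentation_iff_exact]
  exact exists_congr fun π => ⟨fun ⟨w, h, hπ⟩ => ⟨hπ, w, h⟩, fun ⟨hπ, w, h⟩ => ⟨w, h, hπ⟩⟩

lemma isPresentation_cokernel_π {X Y : C} (f : X ⟶ Y) :
    IsPresentation f (cokernel.π (preadditiveYoneda.map f)) :=
  isPresentation_iff_exact.2 ⟨inferInstance, cokernel.condition _, ShortComplex.exact_cokernel _⟩

namespace IsPresentation

variable {X Y : C} {f : X ⟶ Y} {π : preadditiveYoneda.obj Y ⟶ F}

lemma presents (h : IsPresentation f π) : Presents f F :=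
  presents_iff_exists_isPresentation.2 ⟨π, h⟩

lemma exists_map_comp_eq (h : IsPresentation f π) {W : C} (x : preadditiveYoneda.obj W ⟶ F) :
    ∃ a : W ⟶ Y, preadditiveYoneda.map a ≫ π = x := by
  have := h.presents.additive
  obtain ⟨y, rfl⟩ := (epi_iff_forall_exists_comp_eq π).1 h.epi W x
  exact ⟨preadditiveYoneda.preimage y, by rw [Functor.map_preimage]⟩

lemma exists_comp_eq (h : IsPresentation f π) (y : preadditiveYoneda.obj Y ⟶ G)
    (hy : preadditiveYoneda.map f ≫ y = 0) : ∃ t : F ⟶ G, π ≫ t = y := by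
  obtain ⟨_, _, hex⟩ := isPresentation_iff_exact.1 h
  exact ⟨hex.desc y hy, hex.g_desc y hy⟩

lemma comp_iso (h : IsPresentation f π) (e : F ≅ G) : IsPresentation f (π ≫ e.hom) where
  epi := have := h.epi; inferInstance
  map_comp_eq_zero_iff a := by
    rw [← h.map_comp_eq_zero_iff, ← Category.assoc, Preadditive.IsIso.comp_right_eq_zero]

lemma kernelLift (h : IsPresentation f π) {K : C} {k : K ⟶ X} (w : k ≫ f = 0)
    (hk : IsLimit (KernelFork.ofι k w)) :
    IsPresentation k (kernel.lift π (preadditiveYoneda.map f) h.map_comp) where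
  epi := by
    have := h.presents.additive
    have := additive_of_mono (kernel.ι π)
    refine (epi_iff_forall_exists_comp_eq _).2 fun W x => ?_
    obtain ⟨a, ha⟩ := preadditiveYoneda.map_surjective (x ≫ kernel.ι π)
    obtain ⟨b, rfl⟩ := (h.map_comp_eq_zero_iff a).1 (by simp [ha])
    exact ⟨preadditiveYoneda.map b, by simp [← cancel_mono (kernel.ι π), ← ha]⟩
  map_comp_eq_zero_iff {W} a := by
    rw [← cancel_mono (kernel.ι π), zero_comp, Category.assoc, kernel.lift_ι, ← Functor.map_comp,
      Functor.map_eq_zero_iff]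
    refine ⟨fun ha => ?_, ?_⟩
    · obtain ⟨b, hb⟩ := KernelFork.IsLimit.lift' hk a ha
      exact ⟨b, hb⟩
    · rintro ⟨b, rfl⟩
      rw [Category.assoc, w, comp_zero]

lemma factorThruImage (h : IsPresentation f π) {P X' : C} {q : P ⟶ Y} {q' : X' ⟶ X}
    {f' : X' ⟶ P} (sq : IsPullback q' f' f q) :
    IsPresentation f' (Abelian.factorThruImage (preadditiveYoneda.map q ≫ π)) where
  epi := inferInstance
  map_comp_eq_zero_iff {W} a := by
    rw [← cancel_mono (Abelian.image.ι _), zero_comp, Category.assoc, Abelian.image.fac,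
      ← Functor.map_comp_assoc, h.map_comp_eq_zero_iff]
    refine ⟨fun ⟨b, hb⟩ => ⟨sq.lift b a hb, sq.lift_snd b a hb⟩, ?_⟩
    rintro ⟨b, rfl⟩
    exact ⟨b ≫ q', by rw [Category.assoc, Category.assoc, sq.w]⟩

lemma comp_cokernel_π [HasBinaryBiproducts C] (h : IsPresentation f π) {P : C} (q : P ⟶ Y) :
    IsPresentation (biprod.desc f q) (π ≫ cokernel.π (preadditiveYoneda.map q ≫ π)) where
  epi := have := h.epi; epi_comp _ _
  map_comp_eq_zero_iff {W} a := by
    have := h.presents.additive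
    refine ⟨fun ha => ?_, ?_⟩
    · obtain ⟨y, hy⟩ := (exact_iff_forall_exists_comp_eq _).1 (ShortComplex.exact_cokernel _) _
        (preadditiveYoneda.map a ≫ π) ((Category.assoc _ _ _).trans ha)
      obtain ⟨b, rfl⟩ := preadditiveYoneda.map_surjective y
      obtain ⟨d, hd⟩ := (h.map_comp_eq_zero_iff (a - b ≫ q)).1 (by
        simpa [Functor.map_sub, Preadditive.sub_comp, sub_eq_zero] using hy.symm)
      exact ⟨biprod.lift d b, by simp [hd]⟩
    · rintro ⟨b, rfl⟩
      have hb : b ≫ biprod.desc f q = (b ≫ biprod.fst) ≫ f + (b ≫ biprod.snd) ≫ q := by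
        simp [biprod.desc_eq]
      simp only [hb, Functor.map_add, Preadditive.add_comp, Functor.map_comp, Category.assoc,
        reassoc_of% h.map_comp, zero_comp, comp_zero, zero_add]
      rw [← Category.assoc _ π, cokernel.condition, comp_zero, comp_zero]

lemma exists_reflection (h : IsPresentation f π) [HasCokernel f] :
    ∃ θ : F ⟶ preadditiveYoneda.obj (cokernel f), ∀ {A : C} (x : F ⟶ preadditiveYoneda.obj A),
      ∃! k : cokernel f ⟶ A, θ ≫ preadditiveYoneda.map k = x := by
  have := h.epi
  obtain ⟨θ, hθ⟩ := h.exists_comp_eq (preadditiveYoneda.map (cokernel.π f))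
    (by rw [← Functor.map_comp, cokernel.condition, Functor.map_zero])
  refine ⟨θ, fun {A} x => ?_⟩
  obtain ⟨y, hy⟩ := preadditiveYoneda.map_surjective (π ≫ x)
  have hfy : f ≫ y = 0 := preadditiveYoneda.map_injective <| by
    rw [Functor.map_comp, hy, reassoc_of% h.map_comp, zero_comp, Functor.map_zero]
  have factors_iff (k : cokernel f ⟶ A) :
      θ ≫ preadditiveYoneda.map k = x ↔ cokernel.π f ≫ k = y := by
    rw [← cancel_epi π, reassoc_of% hθ, ← Functor.map_comp, ← hy,
      preadditiveYoneda.map_injective.eq_iff]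
  simp only [factors_iff]
  exact ⟨cokernel.desc f y hfy, cokernel.π_desc f y hfy, fun k hk => by
    rw [← cancel_epi (cokernel.π f), hk, cokernel.π_desc]⟩

end IsPresentation

end Yoneda

section Conflations

variable {C : Type u} [Category.{v} C] [Preadditive C] {E : ConflationStructure C}

lemma IsDeflation.epi {X Y : C} {p : X ⟶ Y} (hp : E.IsDeflation p) : Epi p := by
  obtain ⟨_, _, _, hc⟩ := hp
  obtain ⟨h⟩ := E.isCokernel _ hc
  exact ⟨fun _ _ => Cofork.IsColimit.hom_ext h⟩

lemma IsInflation.mono {X Y : C} {i : X ⟶ Y} (hi : E.IsInflation i) : Mono i := by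
  obtain ⟨_, _, _, hc⟩ := hi
  obtain ⟨h⟩ := E.isKernel _ hc
  exact ⟨fun _ _ => Fork.IsLimit.hom_ext h⟩

lemma IsDeflation.hasKernel {X Y : C} {p : X ⟶ Y} (hp : E.IsDeflation p) : HasKernel p := by
  obtain ⟨_, _, _, hc⟩ := hp
  obtain ⟨h⟩ := E.isKernel _ hc
  exact ⟨⟨⟨_, h⟩⟩⟩

lemma IsInflation.hasCokernel {X Y : C} {i : X ⟶ Y} (hi : E.IsInflation i) : HasCokernel i := by
  obtain ⟨_, _, _, hc⟩ := hi
  obtain ⟨h⟩ := E.isCokernel _ hc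
  exact ⟨⟨⟨_, h⟩⟩⟩

lemma IsDeflation.of_iso {X Y X' Y' : C} {p : X ⟶ Y} {p' : X' ⟶ Y'} (hp : E.IsDeflation p)
    (e : X ≅ X') (e' : Y ≅ Y') (comm : e.hom ≫ p' = p ≫ e'.hom) : E.IsDeflation p' := by
  obtain ⟨K, i, w, hc⟩ := hp
  have := E.closed_iso
  have w' : (i ≫ e.hom) ≫ p' = 0 := by rw [Category.assoc, comm, reassoc_of% w, zero_comp]
  exact ⟨K, i ≫ e.hom, w', E.IsConflation.prop_of_iso (ShortComplex.isoMk (S₁ := .mk i p w)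
    (S₂ := .mk (i ≫ e.hom) p' w') (Iso.refl _) e e' (by simp) comm) hc⟩

lemma IsDeflation.isConflation_of_isLimit {K X Y : C} {i : K ⟶ X} {p : X ⟶ Y}
    (hp : E.IsDeflation p) {w : i ≫ p = 0} (hi : IsLimit (KernelFork.ofι i w)) :
    E.IsConflation (ShortComplex.mk i p w) := by
  obtain ⟨_, j, wj, hc⟩ := hp
  obtain ⟨hj⟩ := E.isKernel _ hc
  have := E.closed_iso
  exact E.IsConflation.prop_of_iso (ShortComplex.isoMk (S₁ := .mk j p wj) (S₂ := .mk i p w)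
    (hj.conePointUniqueUpToIso hi) (Iso.refl _) (Iso.refl _)
    (by simpa using hj.conePointUniqueUpToIso_hom_comp hi .zero)) hc

lemma IsInflation.isConflation_of_isColimit {X Y Z : C} {i : X ⟶ Y} {p : Y ⟶ Z}
    (hi : E.IsInflation i) {w : i ≫ p = 0} (hp : IsColimit (CokernelCofork.ofπ p w)) :
    E.IsConflation (ShortComplex.mk i p w) := by
  obtain ⟨_, q, wq, hc⟩ := hi
  obtain ⟨hq⟩ := E.isCokernel _ hc
  have := E.closed_iso
  exact E.IsConflation.prop_of_iso (ShortComplex.isoMk (S₁ := .mk i q wq) (S₂ := .mk i p w)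
    (Iso.refl _) (Iso.refl _) (hq.coconePointUniqueUpToIso hp) (by simp)
    (by simpa using (hq.comp_coconePointUniqueUpToIso_hom hp .one).symm)) hc

lemma IsAdmissible.hasCokernel {X Y : C} {f : X ⟶ Y} (hf : E.IsAdmissible f) :
    HasCokernel f := by
  obtain ⟨I, p, i, hp, hi, rfl⟩ := hf
  have := hp.epi
  have := hi.hasCokernel
  infer_instance

lemma IsAdmissible.hasKernel {X Y : C} {f : X ⟶ Y} (hf : E.IsAdmissible f) : HasKernel f := by
  obtain ⟨I, p, i, hp, hi, rfl⟩ := hf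
  have := hp.hasKernel
  have := hi.mono
  infer_instance

lemma IsAdmissible.isInflation_kernel_ι {X Y : C} {f : X ⟶ Y} [HasKernel f]
    (hf : E.IsAdmissible f) : E.IsInflation (kernel.ι f) := by
  obtain ⟨I, p, i, hp, hi, rfl⟩ := hf
  have := hi.mono
  have w : kernel.ι (p ≫ i) ≫ p = 0 := by simp [← cancel_mono i]
  exact ⟨I, p, w, hp.isConflation_of_isLimit (isKernelOfComp i _ (kernelIsKernel _) w rfl)⟩

instance gen_isClosedUnderIsomorphisms (𝒳 : ObjectProperty C) :
    (E.gen 𝒳).IsClosedUnderIsomorphisms where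
  of_iso := fun e ⟨X, p, hX, hp⟩ => ⟨X, p ≫ e.hom, hX, hp.of_iso (Iso.refl X) e (by simp)⟩

lemma gen_le_leftOrthogonal {𝒳 ℱ : ObjectProperty C} (h : 𝒳 ≤ ℱ.leftOrthogonal) :
    E.gen 𝒳 ≤ ℱ.leftOrthogonal := by
  rintro T ⟨X, p, hX, hp⟩ F f hF
  have := hp.epi
  rw [← cancel_epi p, comp_zero]
  exact h _ hX _ hF

variable (E) in
/-- The objects `M` in the middle of a conflation `T ⟶ M ⟶ F` with `T` in `𝒯` and `F` in `ℱ`. -/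
def extensions (𝒯 ℱ : ObjectProperty C) : ObjectProperty C := fun M =>
  ∃ (T F : C) (i : T ⟶ M) (p : M ⟶ F) (w : i ≫ p = 0),
    𝒯 T ∧ ℱ F ∧ E.IsConflation (ShortComplex.mk i p w)

end Conflations

section Biproducts

variable {C : Type u} [Category.{v} C] [Preadditive C] [HasBinaryBiproducts C]

lemma isPullback_biprod_lift_fst_desc {X P Y : C} (f : X ⟶ Y) (q : P ⟶ Y) :
    IsPullback (biprod.lift biprod.fst (biprod.desc f q)) biprod.snd (biprod.desc (-f) (𝟙 Y)) q :=
  .of_isLimit' ⟨by ext <;> simp⟩ <| PullbackCone.IsLimit.mk _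
    (fun s => biprod.lift (s.fst ≫ biprod.fst) s.snd)
    (fun s => by ext <;> simp [← s.condition, biprod.desc_eq])
    (fun s => by simp)
    (fun s m h₁ h₂ => by ext <;> simp [← h₁, ← h₂])

lemma isPushout_biprod_fst_map {K Z : C} (k : K ⟶ Z) (B : C) :
    IsPushout (biprod.fst : K ⊞ B ⟶ K) (biprod.map k (𝟙 B)) k biprod.fst :=
  .of_isColimit' ⟨by simp⟩ <| PushoutCocone.IsColimit.mk _
    (fun s => biprod.inl ≫ s.inr)
    (fun s => by simpa using (biprod.inl ≫= s.condition).symm)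
    (fun s => biprod.hom_ext' _ _ (by simp) (by simpa using biprod.inr ≫= s.condition))
    (fun s m _ h => by simp [← h])

/-- The fork of `biprod.fst ≫ m` given by `k ⊞ 𝟙` is a kernel if `k` is a kernel of `m`. -/
noncomputable def isLimitKernelForkBiprodFstComp {K Z A : C} {k : K ⟶ Z} {m : Z ⟶ A} (w : k ≫ m = 0)
    (hk : IsLimit (KernelFork.ofι k w)) (B : C) :
    IsLimit (KernelFork.ofι (f := (biprod.fst : Z ⊞ B ⟶ Z) ≫ m) (biprod.map k (𝟙 B))
      (by simp [w])) :=
  have : Mono k := ⟨fun _ _ => Fork.IsLimit.hom_ext hk⟩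
  KernelFork.IsLimit.ofι' _ _ fun a ha =>
    have l := KernelFork.IsLimit.lift' hk (a ≫ biprod.fst) (by simpa using ha)
    ⟨biprod.lift l.1 (a ≫ biprod.snd), by ext <;> simp [show l.1 ≫ k = _ from l.2]⟩

end Biproducts

section Exact

variable {C : Type u} [Category.{v} C] [Preadditive C] {E : ConflationStructure C}

lemma IsExact.isDeflation_of_isIso [HasZeroObject C] (hE : E.IsExact) {X Y : C} (p : X ⟶ Y)
    [IsIso p] : E.IsDeflation p := by
  obtain ⟨Z, hZ⟩ := HasZeroObject.zero (C := C)
  exact hE.deflation_pullback p (0 : X ⟶ Z) 0 (𝟙 Z) (.of_horiz_isIso ⟨by simp⟩)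
    (hE.deflation_to_zero hZ _)

lemma IsExact.isAdmissible_of_isInflation [HasZeroObject C] (hE : E.IsExact) {X Y : C} {i : X ⟶ Y}
    (hi : E.IsInflation i) : E.IsAdmissible i :=
  ⟨X, 𝟙 X, i, hE.isDeflation_of_isIso _, hi, Category.id_comp i⟩

lemma IsExact.isInflation_of_isPullback (hE : E.IsExact) {X' P X Y : C} {q' : X' ⟶ X}
    {i' : X' ⟶ P} {i : X ⟶ Y} {q : P ⟶ Y} (sq : IsPullback q' i' i q) (hi : E.IsInflation i)
    (hq : E.IsDeflation q) : E.IsInflation i' := by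
  have := hi.mono
  have : Mono i' := (MorphismProperty.monomorphisms C).of_isPullback sq this
  obtain ⟨Z, c, w, hc⟩ := hi
  obtain ⟨hker⟩ := E.isKernel _ hc
  have w' : i' ≫ q ≫ c = 0 := by rw [← sq.w_assoc, w, comp_zero]
  refine ⟨Z, q ≫ c, w', (hE.deflation_comp q c hq ⟨X, i, w, hc⟩).isConflation_of_isLimit ?_⟩
  refine KernelFork.IsLimit.ofι' _ _ fun a ha => ?_
  have l := KernelFork.IsLimit.lift' hker (a ≫ q) (by simpa using ha)
  exact ⟨sq.lift l.1 a l.2, sq.lift_snd _ _ _⟩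

lemma IsExact.isAdmissible_of_isPullback (hE : E.IsExact) {X' P X Y : C} {q' : X' ⟶ X}
    {f' : X' ⟶ P} {f : X ⟶ Y} {q : P ⟶ Y} (sq : IsPullback q' f' f q) (hf : E.IsAdmissible f)
    (hq : E.IsDeflation q) : E.IsAdmissible f' := by
  obtain ⟨I, p, i, hp, hi, rfl⟩ := hf
  have := hE.hasPullback q i hq
  have sqi := IsPullback.of_hasPullback i q
  have w : (q' ≫ p) ≫ i = f' ≫ q := (Category.assoc _ _ _).trans sq.w
  have sqp : IsPullback q' (sqi.lift (q' ≫ p) f' w) p (pullback.fst i q) :=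
    .of_bot (by simpa using sq) (sqi.lift_fst _ _ _).symm sqi
  exact ⟨_, _, _, hE.deflation_pullback _ _ _ _ sqp.flip hp, hE.isInflation_of_isPullback sqi hi hq,
    sqi.lift_snd _ _ _⟩

variable [HasBinaryBiproducts C]

lemma IsExact.isDeflation_of_fst_comp (hE : E.IsExact) {Z A B : C} {m : Z ⟶ A} [HasKernel m]
    (h : E.IsDeflation ((biprod.fst : Z ⊞ B ⟶ Z) ≫ m)) : E.IsDeflation m := by
  have hc := h.isConflation_of_isLimit
    (isLimitKernelForkBiprodFstComp (kernel.condition m) (kernelIsKernel m) B)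
  obtain ⟨hcoker⟩ := E.isCokernel _ hc
  have hι : E.IsInflation (kernel.ι m) :=
    hE.inflation_pushout _ _ _ _ (isPushout_biprod_fst_map (kernel.ι m) B) ⟨_, _, _, hc⟩
  have := h.epi
  have : Epi m := epi_of_epi (biprod.fst : Z ⊞ B ⟶ Z) m
  refine ⟨_, _, kernel.condition m, hι.isConflation_of_isColimit
    (CokernelCofork.IsColimit.ofπ' _ _ fun a ha => ?_)⟩
  have l := CokernelCofork.IsColimit.desc' hcoker (biprod.fst ≫ a) (by simp [ha])
  exact ⟨l.1, by simpa [← cancel_epi (biprod.fst : Z ⊞ B ⟶ Z)] using l.2⟩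

variable [HasZeroObject C]

open ZeroObject in
lemma IsExact.isDeflation_biprod_snd (hE : E.IsExact) (X Y : C) :
    E.IsDeflation (biprod.snd : X ⊞ Y ⟶ Y) :=
  hE.deflation_pullback _ _ _ _ (IsPullback.of_has_biproduct X Y).flip
    (hE.deflation_to_zero (isZero_zero C) _)

lemma IsExact.isDeflation_biprod_desc (hE : E.IsExact) {X P Y : C} (f : X ⟶ Y) {q : P ⟶ Y}
    (hq : E.IsDeflation q) : E.IsDeflation (biprod.desc f q) := by
  rw [← biprod.lift_snd (biprod.fst : X ⊞ P ⟶ X) (biprod.desc f q)]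
  exact hE.deflation_comp _ _
    (hE.deflation_pullback _ _ _ _ (isPullback_biprod_lift_fst_desc f q) hq)
    (hE.isDeflation_biprod_snd X Y)

/-- Quillen's obscure axiom. A unipotent automorphism of `Z ⊞ B` carries `biprod.desc m (l ≫ m)` to
`biprod.fst ≫ m`. -/
lemma IsExact.isDeflation_of_comp (hE : E.IsExact) {B Z A : C} (l : B ⟶ Z) {m : Z ⟶ A}
    [HasKernel m] (h : E.IsDeflation (l ≫ m)) : E.IsDeflation m := by
  have hfst : (biprod.fst : Z ⊞ B ⟶ Z) ≫ m =
      (Biprod.unipotentLower (-l)).hom ≫ biprod.desc m (l ≫ m) := by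
    ext <;> simp [Biprod.ofComponents]
  refine hE.isDeflation_of_fst_comp (B := B) ?_
  rw [hfst]
  exact hE.deflation_comp _ _ (hE.isDeflation_of_isIso _) (hE.isDeflation_biprod_desc m h)

end Exact

section Reflective

variable {C D : Type*} [Category* C] [Category* D] (R : C ⥤ D) [Reflective R]

lemma mem_essImage_of_retract {Y : C} {P : D} (r : Retract P (R.obj Y)) : R.essImage P := by
  let adj := reflectorAdjunction R
  have hη : adj.unit.app P ≫ R.map ((adj.homEquiv P Y).symm r.i) = r.i :=
    (adj.homEquiv_unit _ _ _).symm.trans (Equiv.apply_symm_apply _ _)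
  have : IsSplitMono (adj.unit.app P) :=
    .mk' ⟨R.map ((adj.homEquiv P Y).symm r.i) ≫ r.r, by rw [reassoc_of% hη, r.retract]; rfl⟩
  exact mem_essImage_of_unit_isSplitMono

lemma hasKernel_of_hasKernel_map [HasZeroMorphisms C] [HasZeroMorphisms D]
    [R.PreservesZeroMorphisms] {X Y : C} (f : X ⟶ Y) [HasKernel (R.map f)] : HasKernel f :=
  have e : parallelPair (R.map f) 0 ≅ parallelPair f 0 ⋙ R :=
    parallelPair.ext (Iso.refl _) (Iso.refl _) (by simp) (by simp)
  have := hasLimit_of_iso e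
  hasLimit_of_reflective (parallelPair f 0) R

end Reflective

section AdmissiblyPresented

variable {C : Type u} [Category.{v} C] [Preadditive C] {E : ConflationStructure C}

instance additive_smodAdm_obj (M : E.SmodAdm) : M.obj.Additive := by
  obtain ⟨_, _, _, _, h⟩ := M.property
  exact h.additive

instance eff_isClosedUnderIsomorphisms : E.eff.IsClosedUnderIsomorphisms where
  of_iso e := by
    rintro ⟨X, Y, f, hf, h⟩
    obtain ⟨π, h⟩ := presents_iff_exists_isPresentation.1 h
    exact ⟨X, Y, f, hf, (h.comp_iso e).presents⟩

instance effAdm_isClosedUnderIsomorphisms : E.effAdm.IsClosedUnderIsomorphisms :=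
  inferInstanceAs (E.eff.inverseImage E.smodAdm.ι).IsClosedUnderIsomorphisms

lemma IsDeflation.epi_hom {F G : E.SmodAdm} {p : F ⟶ G} (hp : E.smodAdmConflation.IsDeflation p) :
    Epi p.hom := by
  obtain ⟨_, _, _, hc⟩ := hp
  exact ShortComplex.ShortExact.epi_g hc

lemma isDeflation_of_epi_hom {F G : E.SmodAdm} {p : F ⟶ G} (hp : Epi p.hom)
    (hk : E.smodAdm (kernel p.hom)) : E.smodAdmConflation.IsDeflation p :=
  ⟨⟨kernel p.hom, hk⟩, ObjectProperty.homMk (kernel.ι p.hom),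
    ObjectProperty.hom_ext _ (kernel.condition p.hom),
    { exact := ShortComplex.exact_kernel p.hom
      mono_f := inferInstanceAs (Mono (kernel.ι p.hom))
      epi_g := hp }⟩

lemma IsExact.exists_isDeflation_map_comp_eq_zero (hE : E.IsExact) {F : Cᵒᵖ ⥤ AddCommGrpCat.{v}}
    (hF : E.eff F) {A : C} (u : preadditiveYoneda.obj A ⟶ F) :
    ∃ (B : C) (q : B ⟶ A), E.IsDeflation q ∧ preadditiveYoneda.map q ≫ u = 0 := by
  obtain ⟨X, Y, f, hf, h⟩ := hF
  obtain ⟨π, h⟩ := presents_iff_exists_isPresentation.1 h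
  obtain ⟨a, rfl⟩ := h.exists_map_comp_eq u
  have := hE.hasPullback f a hf
  have sq := IsPullback.of_hasPullback a f
  refine ⟨_, _, hE.deflation_pullback _ _ _ _ sq hf, ?_⟩
  rw [← Functor.map_comp_assoc, h.map_comp_eq_zero_iff]
  exact ⟨_, sq.w.symm⟩

variable [HasZeroObject C]

lemma IsExact.smodAdm_yoneda (hE : E.IsExact) (A : C) : E.smodAdm (preadditiveYoneda.obj A) := by
  obtain ⟨Z, hZ⟩ := HasZeroObject.zero (C := C)
  have h : IsPresentation (0 : Z ⟶ A) (𝟙 (preadditiveYoneda.obj A)) :=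
    ⟨inferInstance, fun a => by simp [Functor.map_eq_zero_iff, eq_comm (a := (0 : _ ⟶ A))]⟩
  exact ⟨Z, A, 0, hE.isAdmissible_of_isInflation (hE.inflation_from_zero hZ _), h.presents⟩

/-- The Yoneda embedding, with values in the admissibly presented functors. -/
def IsExact.yonedaAdm (hE : E.IsExact) : C ⥤ E.SmodAdm :=
  E.smodAdm.lift preadditiveYoneda hE.smodAdm_yoneda

instance (hE : E.IsExact) : hE.yonedaAdm.Full :=
  inferInstanceAs (E.smodAdm.lift preadditiveYoneda hE.smodAdm_yoneda).Full

instance (hE : E.IsExact) : hE.yonedaAdm.Faithful :=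
  inferInstanceAs (E.smodAdm.lift preadditiveYoneda hE.smodAdm_yoneda).Faithful

instance (hE : E.IsExact) : hE.yonedaAdm.PreservesZeroMorphisms where
  map_zero _ _ := ObjectProperty.hom_ext _ (preadditiveYoneda.map_zero _ _)

instance (hE : E.IsExact) : hE.yonedaAdm.IsRightAdjoint :=
  have (M : E.SmodAdm) : HasInitial (StructuredArrow M hE.yonedaAdm) := by
    obtain ⟨X, Y, f, hf, h⟩ := M.property
    obtain ⟨π, h⟩ := presents_iff_exists_isPresentation.1 h
    have := hf.hasCokernel
    obtain ⟨θ, hθ⟩ := h.exists_reflection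
    let u : StructuredArrow M hE.yonedaAdm := StructuredArrow.mk (Y := cokernel f) <|
      ObjectProperty.homMk θ
    choose k hk k_unique using fun s : StructuredArrow M hE.yonedaAdm => hθ s.hom.hom
    have hu : IsInitial u := IsInitial.ofUniqueHom
      (fun s => StructuredArrow.homMk (k s) (ObjectProperty.hom_ext _ (hk s)))
      fun s m => StructuredArrow.hom_ext _ _ <| k_unique s _ congr($(StructuredArrow.w m).hom)
    exact hu.hasInitial
  isRightAdjointOfStructuredArrowInitials _

noncomputable instance (hE : E.IsExact) : Reflective hE.yonedaAdm where
  L := hE.yonedaAdm.leftAdjoint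
  adj := Adjunction.ofIsRightAdjoint _

lemma IsExact.isDeflation_of_isPresentation (hE : E.IsExact) {X Y : C} {f : X ⟶ Y} {M : E.SmodAdm}
    {π : hE.yonedaAdm.obj Y ⟶ M} (h : IsPresentation f π.hom) (hf : E.IsAdmissible f) :
    E.smodAdmConflation.IsDeflation π := by
  have := hf.hasKernel
  exact isDeflation_of_epi_hom h.epi ⟨_, _, _,
    hE.isAdmissible_of_isInflation hf.isInflation_kernel_ι,
    (h.kernelLift (kernel.condition f) (kernelIsKernel f)).presents⟩

lemma IsExact.proj_yonedaAdm (hE : E.IsExact) (A : C) :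
    E.smodAdmConflation.proj (hE.yonedaAdm.obj A) := by
  intro F G p hp x
  obtain ⟨y, hy⟩ := (epi_iff_forall_exists_comp_eq p.hom).1 hp.epi_hom A x.hom
  exact ⟨ObjectProperty.homMk y, ObjectProperty.hom_ext _ hy⟩

lemma IsExact.mem_essImage_yonedaAdm_of_proj (hE : E.IsExact) {P : E.SmodAdm}
    (hP : E.smodAdmConflation.proj P) : hE.yonedaAdm.essImage P := by
  obtain ⟨X, Y, f, hf, h⟩ := P.property
  obtain ⟨π, h⟩ := presents_iff_exists_isPresentation.1 h
  let q : hE.yonedaAdm.obj Y ⟶ P := ObjectProperty.homMk π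
  obtain ⟨s, hs⟩ := hP q (hE.isDeflation_of_isPresentation h hf) (𝟙 P)
  exact mem_essImage_of_retract _ ⟨s, q, hs⟩

lemma IsExact.leftOrthogonal_effAdm_yonedaAdm_iff (hE : E.IsExact) {A : C} :
    E.effAdm.leftOrthogonal (hE.yonedaAdm.obj A) ↔ E.proj A := by
  refine ⟨fun h X Y g hg a => ?_, fun hA F x hF => ?_⟩
  · have hc := isPresentation_cokernel_π g
    have hF : E.eff (cokernel (preadditiveYoneda.map g)) := ⟨X, Y, g, hg, hc.presents⟩
    let x : hE.yonedaAdm.obj A ⟶ ⟨_, hE.eff_le_smodAdm _ hF⟩ :=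
      ObjectProperty.homMk (preadditiveYoneda.map a ≫ cokernel.π _)
    exact (hc.map_comp_eq_zero_iff a).1 congr($(h x hF).hom)
  · obtain ⟨B, q, hq, hqx⟩ := hE.exists_isDeflation_map_comp_eq_zero hF x.hom
    obtain ⟨s, hs⟩ := hA q hq (𝟙 A)
    have hqx : hE.yonedaAdm.map q ≫ x = 0 := ObjectProperty.hom_ext _ hqx
    calc
      x = hE.yonedaAdm.map (s ≫ q) ≫ x := by rw [hs, hE.yonedaAdm.map_id, Category.id_comp]
      _ = hE.yonedaAdm.map s ≫ hE.yonedaAdm.map q ≫ x := by rw [Functor.map_comp_assoc]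
      _ = 0 := by rw [hqx, comp_zero]

lemma IsExact.gen_proj_inf_leftOrthogonal_effAdm_iff (hE : E.IsExact) {T : E.SmodAdm} :
    E.smodAdmConflation.gen (E.smodAdmConflation.proj ⊓ E.effAdm.leftOrthogonal) T ↔
      ∃ (A : C) (r : hE.yonedaAdm.obj A ⟶ T),
        E.proj A ∧ E.smodAdmConflation.IsDeflation r := by
  refine ⟨fun ⟨P, r, ⟨hP, hP'⟩, hr⟩ => ?_, fun ⟨A, r, hA, hr⟩ =>
    ⟨_, r, ⟨hE.proj_yonedaAdm A, hE.leftOrthogonal_effAdm_yonedaAdm_iff.2 hA⟩, hr⟩⟩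
  obtain ⟨A, ⟨e⟩⟩ := hE.mem_essImage_yonedaAdm_of_proj hP
  exact ⟨A, e.hom ≫ r,
    hE.leftOrthogonal_effAdm_yonedaAdm_iff.1 (E.effAdm.leftOrthogonal.prop_of_iso e.symm hP'),
    hr.of_iso e.symm (Iso.refl _) (by simp)⟩

variable [HasBinaryBiproducts C]

lemma IsExact.extensions_of_hasEnoughProj (hE : E.IsExact) (hP : E.HasEnoughProj) (M : E.SmodAdm) :
    E.smodAdmConflation.extensions
      (E.smodAdmConflation.gen (E.smodAdmConflation.proj ⊓ E.effAdm.leftOrthogonal)) E.effAdm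
      M := by
  obtain ⟨X, Y, f, hf, h⟩ := M.property
  obtain ⟨π, h⟩ := presents_iff_exists_isPresentation.1 h
  obtain ⟨P, q, hPproj, hq⟩ := hP Y
  have := hE.hasPullback q f hq
  let φ := preadditiveYoneda.map q ≫ π
  have hf' : E.IsAdmissible (pullback.snd f q) :=
    hE.isAdmissible_of_isPullback (.of_hasPullback f q) hf hq
  have hT : IsPresentation (pullback.snd f q) (Abelian.factorThruImage φ) :=
    h.factorThruImage (.of_hasPullback f q)
  have hF : E.eff (cokernel φ) :=
    ⟨_, _, _, hE.isDeflation_biprod_desc f hq, (h.comp_cokernel_π q).presents⟩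
  let T : E.SmodAdm := ⟨Abelian.image φ, _, _, _, hf', hT.presents⟩
  let r : hE.yonedaAdm.obj P ⟶ T := ObjectProperty.homMk (Abelian.factorThruImage φ)
  have hr : E.smodAdmConflation.IsDeflation r := hE.isDeflation_of_isPresentation hT hf'
  exact ⟨T, ⟨_, hE.eff_le_smodAdm _ hF⟩, ObjectProperty.homMk (Abelian.image.ι φ),
    ObjectProperty.homMk (cokernel.π φ), ObjectProperty.hom_ext _ (kernel.condition _),
    hE.gen_proj_inf_leftOrthogonal_effAdm_iff.2 ⟨P, r, hPproj, hr⟩,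
    hF,
    { exact := ShortComplex.exact_kernel (cokernel.π φ)
      mono_f := inferInstanceAs (Mono (kernel.ι (cokernel.π φ)))
      epi_g := inferInstanceAs (Epi (cokernel.π φ)) }⟩

lemma IsExact.gen_proj_of_extensions_yonedaAdm (hE : E.IsExact) {A : C}
    (h : E.smodAdmConflation.extensions
      (E.smodAdmConflation.gen (E.smodAdmConflation.proj ⊓ E.effAdm.leftOrthogonal)) E.effAdm
      (hE.yonedaAdm.obj A)) :
    E.gen E.proj A := by
  obtain ⟨T, F, i, p, w, hT, hF, hc⟩ := h
  obtain ⟨Z, r, hZ, hr⟩ := hE.gen_proj_inf_leftOrthogonal_effAdm_iff.1 hT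
  obtain ⟨m, hm⟩ := hE.yonedaAdm.map_surjective (r ≫ i)
  have hasKernel_m : HasKernel m := by
    have := hr.hasKernel
    have : Mono i := IsInflation.mono ⟨_, _, _, hc⟩
    have : HasKernel (hE.yonedaAdm.map m) := hm ▸ inferInstance
    exact hasKernel_of_hasKernel_map hE.yonedaAdm m
  obtain ⟨B, g, hg, hgp⟩ := hE.exists_isDeflation_map_comp_eq_zero hF p.hom
  obtain ⟨l, hl⟩ : ∃ l : B ⟶ Z, l ≫ m = g := by
    obtain ⟨hi⟩ := E.smodAdmConflation.isKernel _ hc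
    obtain ⟨t, ht⟩ := KernelFork.IsLimit.lift' hi (hE.yonedaAdm.map g)
      (ObjectProperty.hom_ext _ hgp)
    obtain ⟨y, rfl⟩ := hE.proj_yonedaAdm B r hr t
    obtain ⟨l, rfl⟩ := hE.yonedaAdm.map_surjective y
    refine ⟨l, hE.yonedaAdm.map_injective ?_⟩
    rw [Functor.map_comp, hm, ← Category.assoc]
    exact ht
  exact ⟨Z, m, hZ, hE.isDeflation_of_comp l (hl ▸ hg)⟩

end AdmissiblyPresented

end ConflationStructure

theorem mainTheorem10 {C : Type u} [Category.{v} C] [Preadditive C] [HasFiniteBiproducts C]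
    (E : ConflationStructure C) (hE : E.IsExact) :
    List.TFAE
      [E.HasEnoughProj,
       E.smodAdmConflation.IsTorsionPair
         (E.smodAdmConflation.gen (E.smodAdmConflation.proj ⊓ E.effAdm.leftOrthogonal)) E.effAdm,
       ∀ P : E.SmodAdm, E.smodAdmConflation.proj P →
         ∃ (F' F'' : E.SmodAdm) (i : F' ⟶ P) (p : P ⟶ F'') (w : i ≫ p = 0),
           E.smodAdmConflation.gen (E.smodAdmConflation.proj ⊓ E.effAdm.leftOrthogonal) F' ∧
           E.effAdm F'' ∧ E.smodAdmConflation.IsConflation (ShortComplex.mk i p w)] := by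
  have := hasZeroObject_of_hasFiniteBiproducts C
  have := hasBinaryBiproducts_of_finite_biproducts C
  tfae_have 1 → 2 := fun h =>
    { closed_iso_left := ConflationStructure.gen_isClosedUnderIsomorphisms _
      closed_iso_right := ConflationStructure.effAdm_isClosedUnderIsomorphisms
      hom_eq_zero := fun hT hF f =>
        ConflationStructure.gen_le_leftOrthogonal inf_le_right _ hT f hF
      exists_conflation := hE.extensions_of_hasEnoughProj h }
  tfae_have 2 → 3 := fun h P _ => h.exists_conflation P
  tfae_have 3 → 1 := fun h A =>
    hE.gen_proj_of_extensions_yonedaAdm (h _ (hE.proj_yonedaAdm A))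
  tfae_finish
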